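/- Let $M$ be a smooth $n$-manifold, let $0<\epsilon'\le\epsilon$, and let $g(w)$, $w\in[-\epsilon,0]$, be a smooth path of Riemannian metrics on $M$. Assume that the metric $dw^2+g(w)$ has positive scalar curvature on $[-\epsilon,0]\times M$, and that the metric $g(w)$ on $M$ has positive scalar curvature for every $w\in[-\epsilon',0]$. Suppose moreover that, in every local coordinate system $\{x_1,\dots,x_n\}$ on $M$, $$\sum_{i=1}^n\frac{\partial g_{ii}(w)}{\partial w}\ge 0$$ at all points of $[-\epsilon',0]\times M$ covered by the coordinate system. Then for every constant $\Lambda\ge 1$ there is a smooth, positive, non-decreasing function $\beta:[-\epsilon',0]\to\mathbb{R}$ with $$\beta(w)=1\ \text{ for } w\in[-\epsilon',-\epsilon'/2],\qquad \beta(w)=\Lambda\ \text{ for } w\in[-\epsilon'/4,0],$$ such that the metric $\beta^2(w)\,dw^2+g(w)$ has positive scalar curvature on $[-\epsilon',0]\times M$. -/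

import Mathlib

open Set Bundle
open scoped Manifold ContDiff

noncomputable section

/-! ## Scalar curvature of a metric given by its coefficients in coordinates

`s` is the coordinate domain, `G` the matrix of metric coefficients on it. All derivatives are
taken within `s`, so that one-sided derivatives are used at boundary points of `s`. -/

/-- The partial derivative `∂f/∂x_a` at `x`, within `s`. -/
def partialWithin {ι : Type*} [Fintype ι] [DecidableEq ι] (s : Set (ι → ℝ)) (a : ι)
    (f : (ι → ℝ) → ℝ) (x : ι → ℝ) : ℝ :=
  fderivWithin ℝ f s x (Pi.single a 1)

/-- The Christoffel symbol `Γ^k_{ij} = ½ Σ_l G^{kl} (∂_i G_{jl} + ∂_j G_{il} - ∂_l G_{ij})`. -/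
def christoffel {ι : Type*} [Fintype ι] [DecidableEq ι] (s : Set (ι → ℝ))
    (G : (ι → ℝ) → Matrix ι ι ℝ) (k i j : ι) (x : ι → ℝ) : ℝ :=
  (1 / 2) * ∑ l, (G x)⁻¹ k l *
    (partialWithin s i (fun y => G y j l) x + partialWithin s j (fun y => G y i l) x
      - partialWithin s l (fun y => G y i j) x)

/-- The Ricci tensor
`R_{ij} = Σ_k (∂_k Γ^k_{ij} - ∂_j Γ^k_{ik}) + Σ_{k,l} (Γ^k_{kl} Γ^l_{ij} - Γ^k_{jl} Γ^l_{ik})`. -/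
def ricci {ι : Type*} [Fintype ι] [DecidableEq ι] (s : Set (ι → ℝ))
    (G : (ι → ℝ) → Matrix ι ι ℝ) (i j : ι) (x : ι → ℝ) : ℝ :=
  ∑ k, (partialWithin s k (christoffel s G k i j) x - partialWithin s j (christoffel s G k i k) x)
    + ∑ k, ∑ l, (christoffel s G k k l x * christoffel s G l i j x
        - christoffel s G k j l x * christoffel s G l i k x)

/-- The scalar curvature `Σ_{i,j} G^{ij} R_{ij}`. -/
def scalarCurvature {ι : Type*} [Fintype ι] [DecidableEq ι] (s : Set (ι → ℝ))
    (G : (ι → ℝ) → Matrix ι ι ℝ) (x : ι → ℝ) : ℝ :=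
  ∑ i, ∑ j, (G x)⁻¹ i j * ricci s G i j x

/-! ## Metrics on a manifold, in local coordinates

A local coordinate system on `M` is a chart in the maximal smooth atlas. -/

/-- Smooth Riemannian metrics on the smooth `n`-manifold `M`. -/
abbrev SmoothMetric (n : ℕ) (M : Type*) [TopologicalSpace M]
    [ChartedSpace (EuclideanSpace ℝ (Fin n)) M] [IsManifold (𝓡 n) ∞ M] :=
  ContMDiffRiemannianMetric (𝓡 n) ∞ (EuclideanSpace ℝ (Fin n))
    (fun x : M => TangentSpace (𝓡 n) x)

/-- The coordinate domain in `ℝⁿ` of the local coordinate system `φ`. -/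
def coordDomain {n : ℕ} {M : Type*} [TopologicalSpace M]
    (φ : OpenPartialHomeomorph M (EuclideanSpace ℝ (Fin n))) : Set (Fin n → ℝ) :=
  {x | WithLp.toLp 2 x ∈ φ.target}

/-- The coordinate vector field `∂/∂x_i` of `φ`, at the point with coordinates `x`. -/
def coordVector {n : ℕ} {M : Type*} [TopologicalSpace M]
    [ChartedSpace (EuclideanSpace ℝ (Fin n)) M]
    (φ : OpenPartialHomeomorph M (EuclideanSpace ℝ (Fin n))) (i : Fin n) (x : Fin n → ℝ) :
    TangentSpace (𝓡 n) (φ.symm (WithLp.toLp 2 x)) :=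
  mfderiv (𝓡 n) (𝓡 n) φ.symm (WithLp.toLp 2 x)
    (EuclideanSpace.single i (1 : ℝ) : EuclideanSpace ℝ (Fin n))

/-- The matrix of coefficients `g_{ij} = g(∂/∂x_i, ∂/∂x_j)` in the coordinates `φ`. -/
def metricMatrix {n : ℕ} {M : Type*} [TopologicalSpace M]
    [ChartedSpace (EuclideanSpace ℝ (Fin n)) M] [IsManifold (𝓡 n) ∞ M]
    (φ : OpenPartialHomeomorph M (EuclideanSpace ℝ (Fin n))) (g : SmoothMetric n M)
    (x : Fin n → ℝ) : Matrix (Fin n) (Fin n) ℝ :=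
  Matrix.of fun i j => g.inner (φ.symm (WithLp.toLp 2 x)) (coordVector φ i x) (coordVector φ j x)

/-- The metric `g` on `M` has positive scalar curvature. -/
def HasPSC {n : ℕ} {M : Type*} [TopologicalSpace M]
    [ChartedSpace (EuclideanSpace ℝ (Fin n)) M] [IsManifold (𝓡 n) ∞ M]
    (g : SmoothMetric n M) : Prop :=
  ∀ φ ∈ IsManifold.maximalAtlas (𝓡 n) ∞ M, ∀ x ∈ coordDomain φ,
    0 < scalarCurvature (coordDomain φ) (metricMatrix φ g) x

/-! ## Paths of metrics and metrics `η(w)² dw² + g(w)` on `J × M` -/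

/-- `g(w)`, `w ∈ J`, is a smooth path of metrics: in all local coordinates, the coefficients
`g_{ij}(w, x)` are smooth on `J` times the coordinate domain. -/
def IsSmoothPath {n : ℕ} {M : Type*} [TopologicalSpace M]
    [ChartedSpace (EuclideanSpace ℝ (Fin n)) M] [IsManifold (𝓡 n) ∞ M]
    (J : Set ℝ) (g : ℝ → SmoothMetric n M) : Prop :=
  ∀ φ ∈ IsManifold.maximalAtlas (𝓡 n) ∞ M, ∀ i j : Fin n,
    ContDiffOn ℝ ∞ (fun p : ℝ × (Fin n → ℝ) => metricMatrix φ (g p.1) p.2 i j)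
      (J ×ˢ coordDomain φ)

/-- The domain of the coordinates `(w, x_1, …, x_n)` on `J × M` extending the coordinates `φ`. The
index `Sum.inl ()` is that of `w`, the index `Sum.inr i` is that of `x_i`. -/
def collarDomain {n : ℕ} {M : Type*} [TopologicalSpace M] (J : Set ℝ)
    (φ : OpenPartialHomeomorph M (EuclideanSpace ℝ (Fin n))) : Set (Unit ⊕ Fin n → ℝ) :=
  {y | y (Sum.inl ()) ∈ J ∧ (fun i => y (Sum.inr i)) ∈ coordDomain φ}

/-- The matrix of coefficients of the metric `η(w)² dw² + g(w)` in the coordinates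
`(w, x_1, …, x_n)` extending `φ`. -/
def collarMatrix {n : ℕ} {M : Type*} [TopologicalSpace M]
    [ChartedSpace (EuclideanSpace ℝ (Fin n)) M] [IsManifold (𝓡 n) ∞ M]
    (φ : OpenPartialHomeomorph M (EuclideanSpace ℝ (Fin n))) (η : ℝ → ℝ)
    (g : ℝ → SmoothMetric n M) (y : Unit ⊕ Fin n → ℝ) :
    Matrix (Unit ⊕ Fin n) (Unit ⊕ Fin n) ℝ :=
  Matrix.fromBlocks (Matrix.of fun _ _ => η (y (Sum.inl ())) ^ 2) 0 0
    (metricMatrix φ (g (y (Sum.inl ()))) (fun i => y (Sum.inr i)))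

/-- The metric `η(w)² dw² + g(w)` on `J × M` has positive scalar curvature. -/
def CollarHasPSC {n : ℕ} {M : Type*} [TopologicalSpace M]
    [ChartedSpace (EuclideanSpace ℝ (Fin n)) M] [IsManifold (𝓡 n) ∞ M]
    (J : Set ℝ) (η : ℝ → ℝ) (g : ℝ → SmoothMetric n M) : Prop :=
  ∀ φ ∈ IsManifold.maximalAtlas (𝓡 n) ∞ M, ∀ y ∈ collarDomain J φ,
    0 < scalarCurvature (collarDomain J φ) (collarMatrix φ η g) y

end

/-! The proof rests on one formula. For a family `h(w)` of metrics in coordinates and a positive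
function `η(w)`, scal(η² dw² + h) = (1 - η⁻²) scal(h(w)) + η⁻² scal(dw² + h) + η⁻³ η' tr_h(∂h/∂w).
This is `scalarCurvature_warped`, obtained by comparing the Christoffel symbols and Ricci tensors
for `η` with those for `η = 1`.

If `β ≥ 1` is non-decreasing, the first term is nonnegative because the slices have positive scalar
curvature, the second is positive because `dw² + g(w)` does, and the third is nonnegative once
tr_g(∂g/∂w) ≥ 0. So any smooth non-decreasing `β ≥ 1` preserves positivity (`CollarHasPSC.stretch`),
and a smooth step from 1 to `Λ` proves the theorem.

The hypothesis concerns the coordinate sum of the ∂g_ii/∂w, not the metric trace. As it holds in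
every coordinate system, `trace_derivWithin_nonneg` applies it, at a given (w, x), in linearly
changed coordinates whose coordinate vectors are orthonormal for `g(w)` at that point; there the two
sums coincide.

Since derivatives are taken within the domain, restriction from [-ε, 0] to [-ε', 0] also needs an
argument: `scalarCurvature_subset`. -/

noncomputable section

/-! ## Calculus of coordinate derivatives -/

section PartialWithin

variable {ι : Type*} [Fintype ι] [DecidableEq ι] {s t : Set (ι → ℝ)} {x : ι → ℝ}

theorem partialWithin_congr {f g : (ι → ℝ) → ℝ} (h : EqOn f g s) (hx : x ∈ s) (a : ι) :
    partialWithin s a f x = partialWithin s a g x := by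
  rw [partialWithin, partialWithin, fderivWithin_congr h (h hx)]

theorem partialWithin_subset {f : (ι → ℝ) → ℝ} (hst : s ⊆ t) (hs : UniqueDiffWithinAt ℝ s x)
    (hf : DifferentiableWithinAt ℝ f t x) (a : ι) :
    partialWithin s a f x = partialWithin t a f x := by
  rw [partialWithin, partialWithin, fderivWithin_subset hst hs hf]

@[simp] theorem partialWithin_const (c : ℝ) (a : ι) :
    partialWithin s a (fun _ => c) x = 0 := by
  simp [partialWithin]

theorem partialWithin_mul {f g : (ι → ℝ) → ℝ} (hs : UniqueDiffWithinAt ℝ s x)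
    (hf : DifferentiableWithinAt ℝ f s x) (hg : DifferentiableWithinAt ℝ g s x) (a : ι) :
    partialWithin s a (fun y => f y * g y) x
      = f x * partialWithin s a g x + partialWithin s a f x * g x := by
  have := fderivWithin_fun_mul hs hf hg
  simp [partialWithin, this]
  ring

theorem ContDiffOn.partialWithin {f : (ι → ℝ) → ℝ} (hs : UniqueDiffOn ℝ s)
    (hf : ContDiffOn ℝ ∞ f s) (a : ι) : ContDiffOn ℝ ∞ (partialWithin s a f) s :=
  (hf.fderivWithin hs (m := ∞) (by simp)).clm_apply contDiffOn_const

end PartialWithin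

/-! ### Smoothness of determinants and inverse matrices. -/

section Inverse

variable {E : Type*} [NormedAddCommGroup E] [NormedSpace ℝ E]
  {ι : Type*} [Fintype ι] [DecidableEq ι] {s : Set E} {G : E → Matrix ι ι ℝ}

theorem contDiffOn_det (hG : ∀ i j, ContDiffOn ℝ ∞ (fun y => G y i j) s) :
    ContDiffOn ℝ ∞ (fun y => (G y).det) s := by
  simp only [Matrix.det_apply']
  exact ContDiffOn.sum fun σ _ => contDiffOn_const.mul (contDiffOn_prod fun i _ => hG _ _)

/-- By Cramer's rule: each entry of the adjugate is the determinant of the matrix with one row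
replaced by a constant basis vector, so smoothness of determinants suffices. -/
theorem contDiffOn_inv_apply (hG : ∀ i j, ContDiffOn ℝ ∞ (fun y => G y i j) s)
    (hdet : ∀ y ∈ s, (G y).det ≠ 0) (i j : ι) :
    ContDiffOn ℝ ∞ (fun y => (G y)⁻¹ i j) s := by
  simp only [Matrix.inv_def, Ring.inverse_eq_inv', Matrix.smul_apply, smul_eq_mul,
    Matrix.adjugate_apply]
  refine ((contDiffOn_det hG).inv hdet).mul (contDiffOn_det fun k l => ?_)
  by_cases hk : k = j
  · subst hk
    simpa using contDiffOn_const
  · simpa [Matrix.updateRow_apply, hk] using hG k l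

end Inverse

/-! ### Independence of the curvature from the set within which one differentiates. -/

section Locality

variable {ι : Type*} [Fintype ι] [DecidableEq ι] {s t : Set (ι → ℝ)} {x : ι → ℝ}
  {G : (ι → ℝ) → Matrix ι ι ℝ}

theorem contDiffOn_christoffel (hs : UniqueDiffOn ℝ s)
    (hG : ∀ i j, ContDiffOn ℝ ∞ (fun y => G y i j) s) (hdet : ∀ y ∈ s, (G y).det ≠ 0)
    (k i j : ι) : ContDiffOn ℝ ∞ (christoffel s G k i j) s := by
  unfold christoffel
  exact contDiffOn_const.mul (ContDiffOn.sum fun l _ => (contDiffOn_inv_apply hG hdet k l).mul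
    ((((hG j l).partialWithin hs i).add ((hG i l).partialWithin hs j)).sub
      ((hG i j).partialWithin hs l)))

theorem christoffel_subset (hst : s ⊆ t) (hs : UniqueDiffOn ℝ s)
    (hG : ∀ i j, ContDiffOn ℝ ∞ (fun y => G y i j) t) (k i j : ι) (hx : x ∈ s) :
    christoffel s G k i j x = christoffel t G k i j x := by
  have h : ∀ i j a, partialWithin s a (fun y => G y i j) x
      = partialWithin t a (fun y => G y i j) x := fun i j a =>
    partialWithin_subset hst (hs x hx) ((hG i j).differentiableOn (by simp) x (hst hx)) a
  simp only [christoffel, h]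

/-- The scalar curvature computed within a smaller set with unique derivatives is the same. -/
theorem scalarCurvature_subset (hst : s ⊆ t) (hs : UniqueDiffOn ℝ s) (ht : UniqueDiffOn ℝ t)
    (hG : ∀ i j, ContDiffOn ℝ ∞ (fun y => G y i j) t) (hdet : ∀ y ∈ t, (G y).det ≠ 0)
    (hx : x ∈ s) : scalarCurvature s G x = scalarCurvature t G x := by
  have h : ∀ k i j a, partialWithin s a (christoffel s G k i j) x
      = partialWithin t a (christoffel t G k i j) x := fun k i j a => by
    -- The two Christoffel symbols agree only on `s`. They are therefore exchanged while still
    -- differentiating within `s`, and only then is the domain of differentiation enlarged.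
    rw [partialWithin_congr (fun y hy => christoffel_subset hst hs hG k i j hy) hx,
      partialWithin_subset hst (hs x hx)
        ((contDiffOn_christoffel ht hG hdet k i j).differentiableOn (by simp) x (hst hx))]
  simp only [scalarCurvature, ricci, h, christoffel_subset hst hs hG _ _ _ hx]

end Locality

/-! ## The metric `η(w)² dw² + h(w)` in coordinates -/

section Warped

variable {ι : Type*}

/-- The set of all `(w, x)` with `w ∈ J` and `x ∈ U`. -/
def productDomain (J : Set ℝ) (U : Set (ι → ℝ)) : Set (Unit ⊕ ι → ℝ) :=
  {y | y (Sum.inl ()) ∈ J ∧ (fun i => y (Sum.inr i)) ∈ U}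

/-- The coefficient matrix of `η(w)² dw² + h(w)`. -/
def warpedMatrix (η : ℝ → ℝ) (h : ℝ → (ι → ℝ) → Matrix ι ι ℝ) (y : Unit ⊕ ι → ℝ) :
    Matrix (Unit ⊕ ι) (Unit ⊕ ι) ℝ :=
  Matrix.fromBlocks (Matrix.of fun _ _ => η (y (Sum.inl ())) ^ 2) 0 0
    (h (y (Sum.inl ())) (fun i => y (Sum.inr i)))

/-- The point `(w, x)`. -/
def joinCoord (w : ℝ) (x : ι → ℝ) : Unit ⊕ ι → ℝ := Sum.elim (fun _ => w) x

@[simp] theorem joinCoord_inl (w : ℝ) (x : ι → ℝ) (u : Unit) :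
    joinCoord w x (Sum.inl u) = w := rfl

@[simp] theorem joinCoord_inr (w : ℝ) (x : ι → ℝ) (i : ι) :
    joinCoord w x (Sum.inr i) = x i := rfl

theorem joinCoord_eta (y : Unit ⊕ ι → ℝ) :
    joinCoord (y (Sum.inl ())) (fun i => y (Sum.inr i)) = y := by
  ext (_ | _) <;> rfl

theorem joinCoord_mem {J : Set ℝ} {U : Set (ι → ℝ)} {w : ℝ} {x : ι → ℝ} (hw : w ∈ J)
    (hx : x ∈ U) : joinCoord w x ∈ productDomain J U := ⟨hw, hx⟩

/-- Splitting off the coordinate `w`. -/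
def splitCoord (ι : Type*) : (Unit ⊕ ι → ℝ) ≃L[ℝ] ℝ × (ι → ℝ) where
  toFun y := (y (Sum.inl ()), fun i => y (Sum.inr i))
  invFun p := joinCoord p.1 p.2
  left_inv y := joinCoord_eta y
  right_inv _ := rfl
  map_add' _ _ := rfl
  map_smul' _ _ := rfl
  continuous_toFun := by fun_prop
  continuous_invFun := by
    refine continuous_pi ?_
    rintro (_ | i)
    · exact continuous_fst
    · exact (continuous_apply i).comp continuous_snd

@[simp] theorem splitCoord_symm_apply (p : ℝ × (ι → ℝ)) :
    (splitCoord ι).symm p = joinCoord p.1 p.2 := rfl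

variable [Fintype ι] {J : Set ℝ} {U : Set (ι → ℝ)}

theorem uniqueDiffOn_productDomain (hJ : UniqueDiffOn ℝ J) (hU : UniqueDiffOn ℝ U) :
    UniqueDiffOn ℝ (productDomain J U) :=
  (splitCoord ι).uniqueDiffOn_preimage_iff.2 (hJ.prod hU)

theorem hasFDerivAt_joinCoord_right (w : ℝ) (x : ι → ℝ) :
    HasFDerivAt (joinCoord w)
      ((splitCoord ι).symm.toContinuousLinearMap ∘L ContinuousLinearMap.inr ℝ ℝ (ι → ℝ)) x :=
  (splitCoord ι).symm.hasFDerivAt.comp x (hasFDerivAt_prodMk_right w x)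

theorem hasFDerivAt_joinCoord_left (w : ℝ) (x : ι → ℝ) :
    HasFDerivAt (fun t => joinCoord t x)
      ((splitCoord ι).symm.toContinuousLinearMap ∘L ContinuousLinearMap.inl ℝ ℝ (ι → ℝ)) w :=
  (splitCoord ι).symm.hasFDerivAt.comp w (hasFDerivAt_prodMk_left w x)

theorem ContDiffOn.inl_coord {f : ℝ → ℝ} (hf : ContDiffOn ℝ ∞ f J) :
    ContDiffOn ℝ ∞ (fun y : Unit ⊕ ι → ℝ => f (y (Sum.inl ()))) (productDomain J U) :=
  hf.comp (contDiff_apply ℝ ℝ (Sum.inl ())).contDiffOn fun _ hx => hx.1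

variable [DecidableEq ι]

theorem partialWithin_inr {F : (Unit ⊕ ι → ℝ) → ℝ} {w : ℝ} {x : ι → ℝ}
    (hU : UniqueDiffOn ℝ U) (hw : w ∈ J) (hx : x ∈ U)
    (hF : DifferentiableWithinAt ℝ F (productDomain J U) (joinCoord w x)) (k : ι) :
    partialWithin (productDomain J U) (Sum.inr k) F (joinCoord w x)
      = partialWithin U k (fun x => F (joinCoord w x)) x := by
  have := hF.hasFDerivWithinAt.comp x (hasFDerivAt_joinCoord_right w x).hasFDerivWithinAt
    (fun x' (hx' : x' ∈ U) => joinCoord_mem hw hx')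
  have h2 := this.fderivWithin (hU x hx)
  simp only [partialWithin]
  change _ = fderivWithin ℝ (F ∘ joinCoord w) U x _
  rw [h2]
  simp only [ContinuousLinearMap.comp_apply]
  congr 1
  ext (_ | i) <;> simp [Pi.single_apply]

theorem partialWithin_inl {F : (Unit ⊕ ι → ℝ) → ℝ} {w : ℝ} {x : ι → ℝ}
    (hJ : UniqueDiffOn ℝ J) (hw : w ∈ J) (hx : x ∈ U)
    (hF : DifferentiableWithinAt ℝ F (productDomain J U) (joinCoord w x)) :
    partialWithin (productDomain J U) (Sum.inl ()) F (joinCoord w x)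
      = derivWithin (fun t => F (joinCoord t x)) J w := by
  have := hF.hasFDerivWithinAt.comp w (hasFDerivAt_joinCoord_left w x).hasFDerivWithinAt
    (fun w' (hw' : w' ∈ J) => joinCoord_mem hw' hx)
  have h2 := this.fderivWithin (hJ w hw)
  simp only [partialWithin, ← fderivWithin_derivWithin]
  change _ = fderivWithin ℝ (F ∘ fun t => joinCoord t x) J w _
  rw [h2]
  simp only [ContinuousLinearMap.comp_apply]
  congr 1
  ext (_ | i) <;> simp

/-- `h` is a smooth family of invertible matrices, and `J × U` is a domain on which derivatives
are unique. -/
structure IsSmoothFamily (J : Set ℝ) (U : Set (ι → ℝ)) (h : ℝ → (ι → ℝ) → Matrix ι ι ℝ) :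
    Prop where
  uniqueDiffOn_left : UniqueDiffOn ℝ J
  uniqueDiffOn_right : UniqueDiffOn ℝ U
  contDiffOn : ∀ i j, ContDiffOn ℝ ∞ (fun p : ℝ × (ι → ℝ) => h p.1 p.2 i j) (J ×ˢ U)
  det_ne_zero : ∀ w ∈ J, ∀ x ∈ U, (h w x).det ≠ 0

/-- `η` is smooth and positive on `J`. -/
structure IsSmoothPos (J : Set ℝ) (η : ℝ → ℝ) : Prop where
  contDiffOn : ContDiffOn ℝ ∞ η J
  pos : ∀ w ∈ J, 0 < η w

theorem IsSmoothPos.one (J : Set ℝ) : IsSmoothPos J (fun _ => 1) :=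
  ⟨contDiffOn_const, fun _ _ => one_pos⟩

variable {h : ℝ → (ι → ℝ) → Matrix ι ι ℝ} {η : ℝ → ℝ} {w : ℝ} {x : ι → ℝ}
  {y : Unit ⊕ ι → ℝ}

theorem IsSmoothFamily.uniqueDiffOn (hh : IsSmoothFamily J U h) :
    UniqueDiffOn ℝ (productDomain J U) :=
  uniqueDiffOn_productDomain hh.uniqueDiffOn_left hh.uniqueDiffOn_right

theorem IsSmoothFamily.slice (hh : IsSmoothFamily J U h) (hw : w ∈ J) (i j : ι) :
    ContDiffOn ℝ ∞ (fun x => h w x i j) U :=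
  (hh.contDiffOn i j).comp (contDiffOn_const.prodMk contDiffOn_id) fun _ hx => ⟨hw, hx⟩

theorem IsSmoothFamily.product (hh : IsSmoothFamily J U h) (i j : ι) :
    ContDiffOn ℝ ∞ (fun y : Unit ⊕ ι → ℝ => h (y (Sum.inl ())) (fun i => y (Sum.inr i)) i j)
      (productDomain J U) :=
  (hh.contDiffOn i j).comp (splitCoord ι).contDiff.contDiffOn fun _ hx => hx

theorem contDiffOn_warpedMatrix (hh : IsSmoothFamily J U h) (hη : IsSmoothPos J η)
    (i j : Unit ⊕ ι) :
    ContDiffOn ℝ ∞ (fun y => warpedMatrix η h y i j) (productDomain J U) := by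
  rcases i with i | i <;> rcases j with j | j <;>
    simp only [warpedMatrix, Matrix.fromBlocks_apply₁₁, Matrix.fromBlocks_apply₁₂,
      Matrix.fromBlocks_apply₂₁, Matrix.fromBlocks_apply₂₂, Matrix.of_apply, Matrix.zero_apply]
  · exact (hη.contDiffOn.pow 2).inl_coord
  · exact contDiffOn_const
  · exact contDiffOn_const
  · exact hh.product i j

theorem det_warpedMatrix_ne_zero (hh : IsSmoothFamily J U h) (hη : IsSmoothPos J η)
    (hy : y ∈ productDomain J U) : (warpedMatrix η h y).det ≠ 0 := by
  rw [warpedMatrix, Matrix.det_fromBlocks_zero₂₁]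
  refine mul_ne_zero ?_ (hh.det_ne_zero _ hy.1 _ hy.2)
  simpa using (hη.pos _ hy.1).ne'

theorem inv_warpedMatrix (hh : IsSmoothFamily J U h) (hη : IsSmoothPos J η)
    (hw : w ∈ J) (hx : x ∈ U) : (warpedMatrix η h (joinCoord w x))⁻¹
      = Matrix.fromBlocks (Matrix.of fun _ _ => (η w ^ 2)⁻¹) 0 0 (h w x)⁻¹ := by
  apply Matrix.inv_eq_right_inv
  have h1 : (Matrix.of fun _ _ : Unit => η w ^ 2) * (Matrix.of fun _ _ : Unit => (η w ^ 2)⁻¹)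
      = 1 := by
    ext i j
    have := (hη.pos w hw).ne'
    simp [Matrix.mul_apply, this]
  have h2 : h w x * (h w x)⁻¹ = 1 :=
    Matrix.mul_nonsing_inv _ (isUnit_iff_ne_zero.2 (hh.det_ne_zero w hw x hx))
  simp only [warpedMatrix, joinCoord_inl, joinCoord_inr, Matrix.fromBlocks_multiply, h1, h2,
    Matrix.mul_zero, Matrix.zero_mul, add_zero, zero_add, Matrix.fromBlocks_one]

theorem contDiffOn_christoffel_warped (hh : IsSmoothFamily J U h) (hη : IsSmoothPos J η)
    (k i j : Unit ⊕ ι) :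
    ContDiffOn ℝ ∞ (christoffel (productDomain J U) (warpedMatrix η h) k i j)
      (productDomain J U) :=
  contDiffOn_christoffel hh.uniqueDiffOn (contDiffOn_warpedMatrix hh hη)
    (fun _ hy => det_warpedMatrix_ne_zero hh hη hy) k i j

theorem partialWithin_inr_inl_coord (hh : IsSmoothFamily J U h) {f : ℝ → ℝ}
    (hf : ContDiffOn ℝ ∞ f J) (hw : w ∈ J) (hx : x ∈ U) (k : ι) :
    partialWithin (productDomain J U) (Sum.inr k)
      (fun y : Unit ⊕ ι → ℝ => f (y (Sum.inl ()))) (joinCoord w x) = 0 := by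
  rw [partialWithin_inr hh.uniqueDiffOn_right hw hx
    (hf.inl_coord.differentiableOn (by simp) _ (joinCoord_mem hw hx))]
  simp

theorem partialWithin_inl_inl_coord (hh : IsSmoothFamily J U h) {f : ℝ → ℝ}
    (hf : ContDiffOn ℝ ∞ f J) (hw : w ∈ J) (hx : x ∈ U) :
    partialWithin (productDomain J U) (Sum.inl ())
      (fun y : Unit ⊕ ι → ℝ => f (y (Sum.inl ()))) (joinCoord w x) = derivWithin f J w := by
  rw [partialWithin_inl hh.uniqueDiffOn_left hw hx
    (hf.inl_coord.differentiableOn (by simp) _ (joinCoord_mem hw hx))]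
  simp

theorem partialWithin_warped_inl_inl (a : ι) (hh : IsSmoothFamily J U h) (hη : IsSmoothPos J η)
    (hw : w ∈ J) (hx : x ∈ U) (u v : Unit) :
    partialWithin (productDomain J U) (Sum.inr a)
      (fun y => warpedMatrix η h y (Sum.inl u) (Sum.inl v)) (joinCoord w x) = 0 :=
  partialWithin_inr_inl_coord hh (hη.contDiffOn.pow 2) hw hx a

theorem partialWithin_warped_inl_inr (a : Unit ⊕ ι) (y : Unit ⊕ ι → ℝ) (u : Unit) (i : ι) :
    partialWithin (productDomain J U) a
      (fun y => warpedMatrix η h y (Sum.inl u) (Sum.inr i)) y = 0 :=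
  partialWithin_const 0 a

theorem partialWithin_warped_inr_inl (a : Unit ⊕ ι) (y : Unit ⊕ ι → ℝ) (u : Unit) (i : ι) :
    partialWithin (productDomain J U) a
      (fun y => warpedMatrix η h y (Sum.inr i) (Sum.inl u)) y = 0 :=
  partialWithin_const 0 a

theorem partialWithin_inl_warped_inl_inl (hh : IsSmoothFamily J U h) (hη : IsSmoothPos J η)
    (hw : w ∈ J) (hx : x ∈ U) (u v : Unit) :
    partialWithin (productDomain J U) (Sum.inl ())
      (fun y => warpedMatrix η h y (Sum.inl u) (Sum.inl v)) (joinCoord w x)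
        = 2 * η w * derivWithin η J w := by
  have := partialWithin_inl_inl_coord hh (hη.contDiffOn.pow 2) hw hx
  refine Eq.trans this ?_
  rw [derivWithin_fun_pow (hη.contDiffOn.differentiableOn (by simp) w hw)]
  simp

theorem partialWithin_inl_warped_inr_inr (hh : IsSmoothFamily J U h) (hw : w ∈ J) (hx : x ∈ U)
    (i j : ι) :
    partialWithin (productDomain J U) (Sum.inl ())
      (fun y => warpedMatrix η h y (Sum.inr i) (Sum.inr j)) (joinCoord w x)
        = derivWithin (fun t => h t x i j) J w :=
  partialWithin_inl hh.uniqueDiffOn_left hw hx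
    ((hh.product i j).differentiableOn (by simp) _ (joinCoord_mem hw hx))

theorem partialWithin_inr_warped_inr_inr (hh : IsSmoothFamily J U h) (hw : w ∈ J) (hx : x ∈ U)
    (a i j : ι) :
    partialWithin (productDomain J U) (Sum.inr a)
      (fun y => warpedMatrix η h y (Sum.inr i) (Sum.inr j)) (joinCoord w x)
        = partialWithin U a (fun x => h w x i j) x :=
  partialWithin_inr hh.uniqueDiffOn_right hw hx
    ((hh.product i j).differentiableOn (by simp) _ (joinCoord_mem hw hx)) a

/-! ### Christoffel symbols of η² dw² + h(w). -/

theorem christoffel_warped_inl_inl_inl (hh : IsSmoothFamily J U h) (hη : IsSmoothPos J η)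
    (hw : w ∈ J) (hx : x ∈ U) :
    christoffel (productDomain J U) (warpedMatrix η h) (Sum.inl ()) (Sum.inl ()) (Sum.inl ())
      (joinCoord w x) = derivWithin η J w / η w := by
  have := (hη.pos w hw).ne'
  simp only [christoffel, inv_warpedMatrix hh hη hw hx, Fintype.sum_sum_type,
    Finset.univ_unique, Finset.sum_singleton, PUnit.default_eq_unit,
    partialWithin_inl_warped_inl_inl hh hη hw hx, Matrix.fromBlocks_apply₁₁,
    Matrix.fromBlocks_apply₁₂, Matrix.of_apply, Matrix.zero_apply, zero_mul,
    Finset.sum_const_zero]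
  field_simp
  ring

theorem christoffel_warped_inl_inl_inr (hh : IsSmoothFamily J U h) (hη : IsSmoothPos J η)
    (hw : w ∈ J) (hx : x ∈ U) (i : ι) :
    christoffel (productDomain J U) (warpedMatrix η h) (Sum.inl ()) (Sum.inl ()) (Sum.inr i)
      (joinCoord w x) = 0 := by
  simp [christoffel, inv_warpedMatrix hh hη hw hx, partialWithin_warped_inl_inl _ hh hη hw hx,
    partialWithin_warped_inr_inl, partialWithin_warped_inl_inr]

theorem christoffel_warped_inl_inr_inl (hh : IsSmoothFamily J U h) (hη : IsSmoothPos J η)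
    (hw : w ∈ J) (hx : x ∈ U) (i : ι) :
    christoffel (productDomain J U) (warpedMatrix η h) (Sum.inl ()) (Sum.inr i) (Sum.inl ())
      (joinCoord w x) = 0 := by
  simp [christoffel, inv_warpedMatrix hh hη hw hx, partialWithin_warped_inl_inl _ hh hη hw hx,
    partialWithin_warped_inr_inl, partialWithin_warped_inl_inr]

/-- Apart from Γ^w_ww, this is the only symbol that depends on `η`, and it does so only through the
factor η⁻². The comparison with `η = 1` rests on this. -/
theorem christoffel_warped_inl_inr_inr (hh : IsSmoothFamily J U h) (hη : IsSmoothPos J η)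
    (hw : w ∈ J) (hx : x ∈ U) (i j : ι) :
    christoffel (productDomain J U) (warpedMatrix η h) (Sum.inl ()) (Sum.inr i) (Sum.inr j)
      (joinCoord w x) = (η w ^ 2)⁻¹ * (-(1 / 2) * derivWithin (fun t => h t x i j) J w) := by
  simp [christoffel, inv_warpedMatrix hh hη hw hx, partialWithin_warped_inr_inl,
    partialWithin_inl_warped_inr_inr hh hw hx]
  ring

theorem christoffel_warped_inr_inl_inl (hh : IsSmoothFamily J U h) (hη : IsSmoothPos J η)
    (hw : w ∈ J) (hx : x ∈ U) (k : ι) :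
    christoffel (productDomain J U) (warpedMatrix η h) (Sum.inr k) (Sum.inl ()) (Sum.inl ())
      (joinCoord w x) = 0 := by
  simp [christoffel, inv_warpedMatrix hh hη hw hx, partialWithin_warped_inl_inl _ hh hη hw hx,
    partialWithin_warped_inl_inr]

theorem christoffel_warped_inr_inl_inr (hh : IsSmoothFamily J U h) (hη : IsSmoothPos J η)
    (hw : w ∈ J) (hx : x ∈ U) (k j : ι) :
    christoffel (productDomain J U) (warpedMatrix η h) (Sum.inr k) (Sum.inl ()) (Sum.inr j)
      (joinCoord w x)
        = 1 / 2 * ∑ l, (h w x)⁻¹ k l * derivWithin (fun t => h t x j l) J w := by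
  simp [christoffel, inv_warpedMatrix hh hη hw hx, partialWithin_warped_inl_inl _ hh hη hw hx,
    partialWithin_warped_inr_inl, partialWithin_warped_inl_inr,
    partialWithin_inl_warped_inr_inr hh hw hx]

theorem christoffel_warped_inr_inr_inl (hh : IsSmoothFamily J U h) (hη : IsSmoothPos J η)
    (hw : w ∈ J) (hx : x ∈ U) (k j : ι) :
    christoffel (productDomain J U) (warpedMatrix η h) (Sum.inr k) (Sum.inr j) (Sum.inl ())
      (joinCoord w x)
        = 1 / 2 * ∑ l, (h w x)⁻¹ k l * derivWithin (fun t => h t x j l) J w := by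
  simp [christoffel, inv_warpedMatrix hh hη hw hx, partialWithin_warped_inl_inl _ hh hη hw hx,
    partialWithin_warped_inr_inl, partialWithin_warped_inl_inr,
    partialWithin_inl_warped_inr_inr hh hw hx]

theorem christoffel_warped_inr_inr_inr (hh : IsSmoothFamily J U h) (hη : IsSmoothPos J η)
    (hw : w ∈ J) (hx : x ∈ U) (k i j : ι) :
    christoffel (productDomain J U) (warpedMatrix η h) (Sum.inr k) (Sum.inr i) (Sum.inr j)
      (joinCoord w x) = christoffel U (h w) k i j x := by
  simp [christoffel, inv_warpedMatrix hh hη hw hx, partialWithin_inr_warped_inr_inr hh hw hx]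

end Warped

/-! ### Ricci and scalar curvature of η² dw² + h(w). -/

section WarpedCurvature

variable {ι : Type*} {J : Set ℝ} {U : Set (ι → ℝ)}
  {h : ℝ → (ι → ℝ) → Matrix ι ι ℝ} {η : ℝ → ℝ} {w : ℝ} {x : ι → ℝ}

theorem eqOn_productDomain {F F' : (Unit ⊕ ι → ℝ) → ℝ}
    (H : ∀ w ∈ J, ∀ x ∈ U, F (joinCoord w x) = F' (joinCoord w x)) :
    EqOn F F' (productDomain J U) := fun y hy => by
  simpa only [joinCoord_eta] using H _ hy.1 _ hy.2

variable [Fintype ι] [DecidableEq ι]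

/-- The terms ∂_w Γ^w_ww and (Γ^w_ww)² cancel, so `η` enters only through the product Γ^w_ww Σ_k
Γ^k_kw, which vanishes for `η = 1`. -/
theorem ricci_warped_inl_inl (hh : IsSmoothFamily J U h) (hη : IsSmoothPos J η)
    (hw : w ∈ J) (hx : x ∈ U) :
    ricci (productDomain J U) (warpedMatrix η h) (Sum.inl ()) (Sum.inl ()) (joinCoord w x)
      = ricci (productDomain J U) (warpedMatrix (fun _ => 1) h) (Sum.inl ()) (Sum.inl ())
          (joinCoord w x)
        + derivWithin η J w / η w
          * (1 / 2 * ∑ k, ∑ l, (h w x)⁻¹ k l * derivWithin (fun t => h t x k l) J w) := by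
  have h1 := IsSmoothPos.one J
  have hm := joinCoord_mem hw hx
  have e1 : ∀ k a, partialWithin (productDomain J U) a
      (christoffel (productDomain J U) (warpedMatrix η h) (Sum.inr k) (Sum.inl ()) (Sum.inl ()))
      (joinCoord w x) = 0 := fun k a => by
    rw [partialWithin_congr (g := fun _ => 0) (eqOn_productDomain fun w hw x hx =>
      christoffel_warped_inr_inl_inl hh hη hw hx k) hm, partialWithin_const]
  have e1' : ∀ k a, partialWithin (productDomain J U) a
      (christoffel (productDomain J U) (warpedMatrix (fun _ => 1) h) (Sum.inr k) (Sum.inl ())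
        (Sum.inl ())) (joinCoord w x) = 0 := fun k a => by
    rw [partialWithin_congr (g := fun _ => 0) (eqOn_productDomain fun w hw x hx =>
      christoffel_warped_inr_inl_inl hh h1 hw hx k) hm, partialWithin_const]
  have e2 : ∀ k j a, partialWithin (productDomain J U) a
      (christoffel (productDomain J U) (warpedMatrix η h) (Sum.inr k) (Sum.inl ()) (Sum.inr j))
      (joinCoord w x) = partialWithin (productDomain J U) a
      (christoffel (productDomain J U) (warpedMatrix (fun _ => 1) h) (Sum.inr k) (Sum.inl ())
        (Sum.inr j)) (joinCoord w x) := fun k j a =>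
    partialWithin_congr (eqOn_productDomain fun w hw x hx => by
      rw [christoffel_warped_inr_inl_inr hh hη hw hx, christoffel_warped_inr_inl_inr hh h1 hw hx])
      hm a
  simp only [ricci, Fintype.sum_sum_type, Finset.univ_unique, Finset.sum_singleton,
    PUnit.default_eq_unit, e1, e1', e2, christoffel_warped_inl_inl_inl hh hη hw hx,
    christoffel_warped_inl_inl_inl hh h1 hw hx, christoffel_warped_inl_inl_inr hh hη hw hx,
    christoffel_warped_inl_inl_inr hh h1 hw hx,
    christoffel_warped_inr_inl_inl hh hη hw hx,
    christoffel_warped_inr_inl_inl hh h1 hw hx, christoffel_warped_inr_inl_inr hh hη hw hx,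
    christoffel_warped_inr_inl_inr hh h1 hw hx, christoffel_warped_inr_inr_inl hh hη hw hx,
    christoffel_warped_inr_inr_inl hh h1 hw hx, derivWithin_fun_const]
  simp only [Pi.zero_apply, zero_div, mul_zero, sub_zero, zero_sub, sub_self,
    Finset.sum_const_zero, add_zero, zero_add, Finset.sum_add_distrib, Finset.sum_neg_distrib,
    ← Finset.sum_mul, ← Finset.mul_sum]
  ring

/-- The symbols with all indices in the slice give the Ricci tensor of `h w`. Every other surviving
term is linear in symbols Γ^w_ij, hence scales by η⁻². Two terms contain η': differentiating η⁻² in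
∂_w Γ^w_ij contributes η⁻² (η'/η) ∂_w h_ij, and Γ^w_ww Γ^w_ij takes away half of it. -/
theorem ricci_warped_inr_inr (hh : IsSmoothFamily J U h) (hη : IsSmoothPos J η)
    (hw : w ∈ J) (hx : x ∈ U) (i j : ι) :
    ricci (productDomain J U) (warpedMatrix η h) (Sum.inr i) (Sum.inr j) (joinCoord w x)
      = ricci U (h w) i j x + (η w ^ 2)⁻¹ *
        (ricci (productDomain J U) (warpedMatrix (fun _ => 1) h) (Sum.inr i) (Sum.inr j)
          (joinCoord w x) - ricci U (h w) i j x
        + derivWithin η J w / η w * (1 / 2 * derivWithin (fun t => h t x i j) J w)) := by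
  have h1 := IsSmoothPos.one J
  have hm := joinCoord_mem hw hx
  have hη0 := (hη.pos w hw).ne'
  have e1 : ∀ {η} (_ : IsSmoothPos J η), ∀ i a, partialWithin (productDomain J U) a
      (christoffel (productDomain J U) (warpedMatrix η h) (Sum.inl ()) (Sum.inr i) (Sum.inl ()))
      (joinCoord w x) = 0 := fun hη i a => by
    rw [partialWithin_congr (g := fun _ => 0) (eqOn_productDomain fun w hw x hx =>
      christoffel_warped_inl_inr_inl hh hη hw hx i) hm, partialWithin_const]
  have e2 : ∀ {η} (_ : IsSmoothPos J η), ∀ k i j a, partialWithin (productDomain J U) (Sum.inr a)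
      (christoffel (productDomain J U) (warpedMatrix η h) (Sum.inr k) (Sum.inr i) (Sum.inr j))
      (joinCoord w x) = partialWithin U a (christoffel U (h w) k i j) x := fun hη k i j a => by
    rw [partialWithin_inr hh.uniqueDiffOn_right hw hx
      ((contDiffOn_christoffel_warped hh hη _ _ _).differentiableOn (by simp) _ hm)]
    exact partialWithin_congr (fun x hx => christoffel_warped_inr_inr_inr hh hη hw hx k i j) hx a
  -- Product rule for Γ^w_ij(η) = η⁻² Γ^w_ij(1).
  have e3 : partialWithin (productDomain J U) (Sum.inl ())
      (christoffel (productDomain J U) (warpedMatrix η h) (Sum.inl ()) (Sum.inr i) (Sum.inr j))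
      (joinCoord w x) = (η w ^ 2)⁻¹ * partialWithin (productDomain J U) (Sum.inl ())
      (christoffel (productDomain J U) (warpedMatrix (fun _ => 1) h) (Sum.inl ()) (Sum.inr i)
        (Sum.inr j)) (joinCoord w x)
      + (η w ^ 2)⁻¹ * (derivWithin η J w / η w) * derivWithin (fun t => h t x i j) J w := by
    have hη2 : ContDiffOn ℝ ∞ (fun t => (η t ^ 2)⁻¹) J :=
      (hη.contDiffOn.pow 2).inv fun t ht => pow_ne_zero 2 (hη.pos t ht).ne'
    have hd := hη.contDiffOn.differentiableOn (by simp) w hw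
    rw [partialWithin_congr (g := fun y => (η (y (Sum.inl ())) ^ 2)⁻¹ *
        christoffel (productDomain J U) (warpedMatrix (fun _ => 1) h) (Sum.inl ()) (Sum.inr i)
          (Sum.inr j) y) (eqOn_productDomain fun w hw x hx => by
        rw [christoffel_warped_inl_inr_inr hh hη hw hx,
          christoffel_warped_inl_inr_inr hh h1 hw hx]; simp) hm,
      partialWithin_mul (hh.uniqueDiffOn _ hm)
        (hη2.inl_coord.differentiableOn (by simp) _ hm)
        ((contDiffOn_christoffel_warped hh h1 _ _ _).differentiableOn (by simp) _ hm),
      partialWithin_inl_inl_coord hh hη2 hw hx, christoffel_warped_inl_inr_inr hh h1 hw hx,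
      derivWithin_fun_inv' (c := fun t => η t ^ 2) (hd.fun_pow 2) (pow_ne_zero 2 hη0), derivWithin_fun_pow hd]
    simp only [joinCoord_inl]
    field_simp
    ring
  simp only [ricci, Fintype.sum_sum_type, Finset.univ_unique, Finset.sum_singleton,
    PUnit.default_eq_unit, e1 hη, e1 h1, e2 hη, e2 h1, e3,
    christoffel_warped_inl_inl_inl hh hη hw hx,
    christoffel_warped_inl_inl_inl hh h1 hw hx, christoffel_warped_inl_inl_inr hh hη hw hx,
    christoffel_warped_inl_inl_inr hh h1 hw hx, christoffel_warped_inl_inr_inl hh hη hw hx,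
    christoffel_warped_inl_inr_inl hh h1 hw hx, christoffel_warped_inr_inr_inl hh hη hw hx,
    christoffel_warped_inr_inr_inl hh h1 hw hx, christoffel_warped_inr_inr_inr hh hη hw hx,
    christoffel_warped_inr_inr_inr hh h1 hw hx, christoffel_warped_inl_inr_inr hh hη hw hx,
    christoffel_warped_inl_inr_inr hh h1 hw hx, derivWithin_fun_const]
  -- What remains is polynomial in η'/η and η⁻²; as atoms they can be pulled out of the sums.
  generalize derivWithin η J w / η w = a
  generalize (η w ^ 2)⁻¹ = c
  simp only [Pi.zero_apply, zero_div, mul_zero, zero_mul, sub_zero, zero_sub, sub_self,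
    zero_add, one_pow, inv_one, one_mul, Finset.sum_add_distrib,
    Finset.sum_sub_distrib, Finset.sum_neg_distrib, mul_left_comm _ c, mul_assoc c,
    ← Finset.sum_mul, ← Finset.mul_sum]
  ring

/-- Scalar curvature of `η² dw² + h(w)` in terms of that of `dw² + h(w)` and that of the slice. -/
theorem scalarCurvature_warped (hh : IsSmoothFamily J U h) (hη : IsSmoothPos J η)
    (hw : w ∈ J) (hx : x ∈ U) :
    scalarCurvature (productDomain J U) (warpedMatrix η h) (joinCoord w x)
      = (1 - (η w ^ 2)⁻¹) * scalarCurvature U (h w) x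
        + (η w ^ 2)⁻¹ * scalarCurvature (productDomain J U) (warpedMatrix (fun _ => 1) h)
            (joinCoord w x)
        + (η w ^ 2)⁻¹ * (derivWithin η J w / η w)
          * ∑ k, ∑ l, (h w x)⁻¹ k l * derivWithin (fun t => h t x k l) J w := by
  have h1 := IsSmoothPos.one J
  -- The inverse matrix is block diagonal, so mixed Ricci components never enter. The ww part and
  -- the slice part each supply half of the trace term.
  simp only [scalarCurvature, Fintype.sum_sum_type, Finset.univ_unique, Finset.sum_singleton,
    PUnit.default_eq_unit, inv_warpedMatrix hh hη hw hx, inv_warpedMatrix hh h1 hw hx,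
    Matrix.fromBlocks_apply₁₁, Matrix.fromBlocks_apply₁₂, Matrix.fromBlocks_apply₂₁,
    Matrix.fromBlocks_apply₂₂, Matrix.of_apply, Matrix.zero_apply, zero_mul,
    Finset.sum_const_zero, add_zero, zero_add, ricci_warped_inl_inl hh hη hw hx,
    ricci_warped_inr_inr hh hη hw hx, mul_add, mul_sub, Finset.sum_add_distrib,
    Finset.sum_sub_distrib, one_pow, inv_one, one_mul, mul_left_comm ((h w x)⁻¹ _ _),
    ← Finset.mul_sum]
  ring

end WarpedCurvature

/-! ## Metrics in local coordinates -/

section Charts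

variable {n : ℕ} {M : Type*} [TopologicalSpace M]
  {φ : OpenPartialHomeomorph M (EuclideanSpace ℝ (Fin n))}

theorem isOpen_coordDomain (φ : OpenPartialHomeomorph M (EuclideanSpace ℝ (Fin n))) :
    IsOpen (coordDomain φ) :=
  φ.open_target.preimage (PiLp.continuous_toLp 2 _)

/-- The coordinate system `e ∘ φ` for a linear automorphism `e` of the model space. -/
def linearTrans (φ : OpenPartialHomeomorph M (EuclideanSpace ℝ (Fin n)))
    (e : EuclideanSpace ℝ (Fin n) ≃L[ℝ] EuclideanSpace ℝ (Fin n)) :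
    OpenPartialHomeomorph M (EuclideanSpace ℝ (Fin n)) :=
  φ.transHomeomorph e.toHomeomorph

variable (e : EuclideanSpace ℝ (Fin n) ≃L[ℝ] EuclideanSpace ℝ (Fin n))

theorem mem_coordDomain_linearTrans {x : Fin n → ℝ} (hx : x ∈ coordDomain φ) :
    (e (WithLp.toLp 2 x)).ofLp ∈ coordDomain (linearTrans φ e) := by
  change e.symm (e _) ∈ φ.target
  rwa [e.symm_apply_apply]

variable [ChartedSpace (EuclideanSpace ℝ (Fin n)) M]

theorem mdifferentiableAt_symm_chart (hφ : φ ∈ IsManifold.maximalAtlas (𝓡 n) ∞ M)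
    {z : EuclideanSpace ℝ (Fin n)} (hz : z ∈ φ.target) :
    MDifferentiableAt (𝓡 n) (𝓡 n) φ.symm z :=
  ((contMDiffOn_symm_of_mem_maximalAtlas hφ).contMDiffAt
    (φ.open_target.mem_nhds hz)).mdifferentiableAt (by simp)

theorem mfderiv_symm_chart_injective (hφ : φ ∈ IsManifold.maximalAtlas (𝓡 n) ∞ M)
    {z : EuclideanSpace ℝ (Fin n)} (hz : z ∈ φ.target) :
    Function.Injective (mfderiv (𝓡 n) (𝓡 n) φ.symm z) := by
  have hd : φ.MDifferentiable (𝓡 n) (𝓡 n) :=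
    ⟨(contMDiffOn_of_mem_maximalAtlas hφ).mdifferentiableOn (by simp),
      (contMDiffOn_symm_of_mem_maximalAtlas hφ).mdifferentiableOn (by simp)⟩
  exact hd.symm.mfderiv_injective hz

theorem mfderiv_symm_linearTrans (hφ : φ ∈ IsManifold.maximalAtlas (𝓡 n) ∞ M)
    {z : EuclideanSpace ℝ (Fin n)} (hz : z ∈ φ.target) (v : EuclideanSpace ℝ (Fin n)) :
    mfderiv (𝓡 n) (𝓡 n) (linearTrans φ e).symm (e z) v
      = mfderiv (𝓡 n) (𝓡 n) φ.symm z (e.symm v) := by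
  have h1 : mfderiv (𝓡 n) (𝓡 n) (φ.symm ∘ e.symm) (e z)
      = (mfderiv (𝓡 n) (𝓡 n) φ.symm (e.symm (e z))).comp
        (mfderiv (𝓡 n) (𝓡 n) e.symm (e z)) :=
    mfderiv_comp (e z) (mdifferentiableAt_symm_chart hφ (by simpa using hz))
      e.symm.mdifferentiableAt
  rw [ContinuousLinearEquiv.mfderiv_eq, e.symm_apply_apply] at h1
  exact DFunLike.congr_fun h1 v

variable [IsManifold (𝓡 n) ∞ M]

theorem linearTrans_mem (hφ : φ ∈ IsManifold.maximalAtlas (𝓡 n) ∞ M) :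
    linearTrans φ e ∈ IsManifold.maximalAtlas (𝓡 n) ∞ M := by
  apply OpenPartialHomeomorph.mem_maximalAtlas_of_contMDiffOn
  · exact e.contDiff.contMDiff.comp_contMDiffOn (contMDiffOn_of_mem_maximalAtlas hφ)
  · exact (contMDiffOn_symm_of_mem_maximalAtlas hφ).comp e.symm.contDiff.contMDiff.contMDiffOn
      fun _ hx => hx

/-- The coefficients of `g` as a quadratic form on coordinate vectors. -/
theorem inner_mfderiv_symm_chart (g : SmoothMetric n M) (x : Fin n → ℝ)
    (v v' : EuclideanSpace ℝ (Fin n)) :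
    g.inner (φ.symm (WithLp.toLp 2 x)) (mfderiv (𝓡 n) (𝓡 n) φ.symm (WithLp.toLp 2 x) v)
        (mfderiv (𝓡 n) (𝓡 n) φ.symm (WithLp.toLp 2 x) v')
      = ∑ k, ∑ l, v k * v' l * metricMatrix φ g x k l := by
  have hv : ∀ v : EuclideanSpace ℝ (Fin n), mfderiv (𝓡 n) (𝓡 n) φ.symm (WithLp.toLp 2 x) v
      = ∑ k, v k • coordVector φ k x := fun v => by
    have h : v = ∑ k, v k • (EuclideanSpace.single k (1 : ℝ) : EuclideanSpace ℝ (Fin n)) := by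
      ext i
      simp [Pi.single_apply]
    conv_lhs => rw [h]
    refine (map_sum _ _ _).trans (Finset.sum_congr rfl fun k _ => ?_)
    exact map_smul _ _ _
  rw [hv v, hv v']
  simp only [map_sum, map_smul, sum_apply, smul_apply,
    smul_eq_mul, metricMatrix, Matrix.of_apply, mul_assoc, Finset.mul_sum]
  rw [Finset.sum_comm]
  simp only [mul_left_comm]

theorem metricMatrix_posDef (hφ : φ ∈ IsManifold.maximalAtlas (𝓡 n) ∞ M) (g : SmoothMetric n M)
    {x : Fin n → ℝ} (hx : x ∈ coordDomain φ) : (metricMatrix φ g x).PosDef := by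
  refine Matrix.PosDef.of_dotProduct_mulVec_pos ?_ fun v hv => ?_
  · ext i j
    exact g.symm _ _ _
  · have h := inner_mfderiv_symm_chart (φ := φ) g x (WithLp.toLp 2 v) (WithLp.toLp 2 v)
    have h0 : mfderiv (𝓡 n) (𝓡 n) φ.symm (WithLp.toLp 2 x) (WithLp.toLp 2 v) ≠ 0 := by
      intro h0
      have := mfderiv_symm_chart_injective hφ hx (h0.trans (map_zero _).symm)
      exact hv ((WithLp.toLp_eq_zero 2).1 this)
    have hp := g.pos _ _ h0
    rw [h] at hp
    simp only [star_trivial, dotProduct, Matrix.mulVec, Finset.mul_sum]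
    refine hp.trans_eq (Finset.sum_congr rfl fun k _ => Finset.sum_congr rfl fun l _ => ?_)
    ring

/-- The coordinate vectors of `e ∘ φ` are the images under `φ.symm` of `e.symm` applied to the
standard basis, so the coefficient matrix changes by a congruence independent of the metric. -/
theorem metricMatrix_linearTrans (hφ : φ ∈ IsManifold.maximalAtlas (𝓡 n) ∞ M)
    (g : SmoothMetric n M) {x : Fin n → ℝ} (hx : x ∈ coordDomain φ) (i j : Fin n) :
    metricMatrix (linearTrans φ e) g (e (WithLp.toLp 2 x)).ofLp i j
      = ∑ k, ∑ l, e.symm (EuclideanSpace.single i 1) k * e.symm (EuclideanSpace.single j 1) l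
          * metricMatrix φ g x k l := by
  rw [← inner_mfderiv_symm_chart, ← mfderiv_symm_linearTrans e hφ hx,
    ← mfderiv_symm_linearTrans e hφ hx]
  have hz : φ.symm (WithLp.toLp 2 x) = (linearTrans φ e).symm (e (WithLp.toLp 2 x)) := by
    change _ = φ.symm (e.symm (e _))
    rw [e.symm_apply_apply]
  rw [hz]
  rfl

end Charts

/-! ### Linear algebra for choosing an orthonormal coordinate frame. -/

open scoped ComplexOrder MatrixOrder in
theorem Matrix.PosDef.exists_eq_mul_transpose {m : Type*} [Fintype m] [DecidableEq m]
    {A : Matrix m m ℝ} (hA : A.PosDef) : ∃ B : Matrix m m ℝ, IsUnit B ∧ A = B * B.transpose := by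
  obtain ⟨B, hB⟩ := CStarAlgebra.nonneg_iff_eq_star_mul_self.1
    (Matrix.nonneg_iff_posSemidef.2 hA.posSemidef)
  have hB' : A = B.transpose * B := by
    simpa [Matrix.star_eq_conjTranspose, Matrix.conjTranspose_eq_transpose_of_trivial] using hB
  refine ⟨B.transpose, ?_, by simpa using hB'⟩
  rw [Matrix.isUnit_iff_isUnit_det, isUnit_iff_ne_zero, Matrix.det_transpose]
  intro h0
  apply hA.det_pos.ne'
  rw [hB', Matrix.det_mul, h0, mul_zero]

/-- An invertible matrix as an automorphism of Euclidean space. -/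
theorem exists_continuousLinearEquiv_single {n : ℕ} {B : Matrix (Fin n) (Fin n) ℝ}
    (hB : IsUnit B) : ∃ e : EuclideanSpace ℝ (Fin n) ≃L[ℝ] EuclideanSpace ℝ (Fin n),
      ∀ i k, e (EuclideanSpace.single i 1) k = B k i := by
  obtain ⟨u, rfl⟩ := hB
  refine ⟨ContinuousLinearEquiv.unitsEquiv ℝ _
    (Units.map (Matrix.toEuclideanCLM (n := Fin n) (𝕜 := ℝ) : _ →* _) u), fun i k => ?_⟩
  change (Matrix.toEuclideanCLM (n := Fin n) (𝕜 := ℝ) u.val (EuclideanSpace.single i 1)) k = _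
  simp [Matrix.ofLp_toEuclideanCLM]

/-! ### The metric trace, restriction of the collar, and stretching. -/

section Paths

variable {n : ℕ} {M : Type*} [TopologicalSpace M]
  [ChartedSpace (EuclideanSpace ℝ (Fin n)) M] [IsManifold (𝓡 n) ∞ M]
  {φ : OpenPartialHomeomorph M (EuclideanSpace ℝ (Fin n))} {J : Set ℝ} {g : ℝ → SmoothMetric n M}

/-- Links manifolds to the coordinate computations: for this family, `collarDomain` and
`collarMatrix` unfold to `productDomain` and `warpedMatrix`. -/
theorem IsSmoothPath.isSmoothFamily (hg : IsSmoothPath J g) (hJ : UniqueDiffOn ℝ J)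
    (hφ : φ ∈ IsManifold.maximalAtlas (𝓡 n) ∞ M) :
    IsSmoothFamily J (coordDomain φ) (fun w => metricMatrix φ (g w)) where
  uniqueDiffOn_left := hJ
  uniqueDiffOn_right := (isOpen_coordDomain φ).uniqueDiffOn
  contDiffOn := hg φ hφ
  det_ne_zero w _ _ hx := (metricMatrix_posDef hφ (g w) hx).det_pos.ne'

/-- If the coordinate traces `Σ_i ∂g_ii/∂w` are nonnegative in all coordinates, then so is the
metric trace of `∂g/∂w`. -/
theorem trace_derivWithin_nonneg (hg : IsSmoothPath J g)
    (hφ : φ ∈ IsManifold.maximalAtlas (𝓡 n) ∞ M) {w : ℝ} (hw : w ∈ J)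
    (hmono : ∀ φ ∈ IsManifold.maximalAtlas (𝓡 n) ∞ M, ∀ x ∈ coordDomain φ,
      0 ≤ ∑ i : Fin n, derivWithin (fun t => metricMatrix φ (g t) x i i) J w)
    {x : Fin n → ℝ} (hx : x ∈ coordDomain φ) :
    0 ≤ ∑ k, ∑ l, (metricMatrix φ (g w) x)⁻¹ k l
      * derivWithin (fun t => metricMatrix φ (g t) x k l) J w := by
  -- With G⁻¹ = B Bᵀ at the fixed (w, x), the columns of `B` are orthonormal for G, and Σ_i B_ki
  -- B_li = G⁻¹_kl turns the coordinate sum into the metric trace.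
  obtain ⟨B, hB, hBH⟩ := (metricMatrix_posDef hφ (g w) hx).inv.exists_eq_mul_transpose
  obtain ⟨e, he⟩ := exists_continuousLinearEquiv_single hB
  have hd : ∀ k l, DifferentiableWithinAt ℝ (fun t => metricMatrix φ (g t) x k l) J w :=
    fun k l => ((hg φ hφ k l).comp (contDiffOn_id.prodMk contDiffOn_const)
      fun t ht => ⟨ht, hx⟩).differentiableOn (by simp) w hw
  -- The chart is composed with `e.symm` so that its i-th coordinate vector is the i-th column of
  -- `B`. The change of coordinates does not depend on the path parameter, so it commutes with the
  -- derivative.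
  have h := hmono _ (linearTrans_mem e.symm hφ) _ (mem_coordDomain_linearTrans e.symm hx)
  simp only [metricMatrix_linearTrans e.symm hφ _ hx, ContinuousLinearEquiv.symm_symm, he] at h
  have hs : ∀ i, derivWithin
      (fun t => ∑ k, ∑ l, B k i * B l i * metricMatrix φ (g t) x k l) J w
      = ∑ k, ∑ l, B k i * B l i * derivWithin (fun t => metricMatrix φ (g t) x k l) J w :=
    fun i => by
      rw [derivWithin_fun_sum fun k _ => DifferentiableWithinAt.fun_sum fun l _ =>
        (hd k l).const_mul _]
      refine Finset.sum_congr rfl fun k _ => ?_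
      rw [derivWithin_fun_sum fun l _ => (hd k l).const_mul _]
      exact Finset.sum_congr rfl fun l _ => derivWithin_const_mul _ (hd k l)
  simp only [hs] at h
  rw [Finset.sum_comm] at h
  refine h.trans_eq (Finset.sum_congr rfl fun k _ => ?_)
  rw [Finset.sum_comm]
  refine Finset.sum_congr rfl fun l _ => ?_
  rw [hBH, Matrix.mul_apply, Finset.sum_mul]
  rfl

/-- Not a mere restriction of a pointwise statement: at a new endpoint of the interval, derivatives
within `J'` are one-sided where those within `J` may be two-sided. Smoothness makes them agree. -/
theorem CollarHasPSC.mono {J' : Set ℝ} {η : ℝ → ℝ} (h : CollarHasPSC J η g)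
    (hg : IsSmoothPath J g) (hJ : UniqueDiffOn ℝ J) (hJ' : UniqueDiffOn ℝ J') (hJJ' : J' ⊆ J)
    (hη : IsSmoothPos J η) : CollarHasPSC J' η g := by
  intro φ hφ y hy
  have hf := hg.isSmoothFamily hJ hφ
  have hs : collarDomain J' φ ⊆ collarDomain J φ := fun y hy => ⟨hJJ' hy.1, hy.2⟩
  exact (h φ hφ y (hs hy)).trans_eq (scalarCurvature_subset hs
    (uniqueDiffOn_productDomain hJ' hf.uniqueDiffOn_right) hf.uniqueDiffOn
    (contDiffOn_warpedMatrix hf hη) (fun _ hy => det_warpedMatrix_ne_zero hf hη hy) hy).symm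

theorem IsSmoothPath.mono {J' : Set ℝ} (hg : IsSmoothPath J g) (hJJ' : J' ⊆ J) :
    IsSmoothPath J' g := fun φ hφ i j => (hg φ hφ i j).mono (prod_mono hJJ' Subset.rfl)

/-- Stretching the collar direction by `β ≥ 1`, non-decreasing, preserves positive scalar
curvature. -/
theorem CollarHasPSC.stretch {β : ℝ → ℝ} (h : CollarHasPSC J (fun _ => 1) g)
    (hg : IsSmoothPath J g) (hJ : UniqueDiffOn ℝ J) (hslice : ∀ w ∈ J, HasPSC (g w))
    (hmono : ∀ φ ∈ IsManifold.maximalAtlas (𝓡 n) ∞ M, ∀ w ∈ J, ∀ x ∈ coordDomain φ,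
      0 ≤ ∑ i : Fin n, derivWithin (fun t => metricMatrix φ (g t) x i i) J w)
    (hβ : ContDiffOn ℝ ∞ β J) (hβm : MonotoneOn β J) (hβ1 : ∀ w ∈ J, 1 ≤ β w) :
    CollarHasPSC J β g := by
  intro φ hφ y hy
  have hpos : IsSmoothPos J β := ⟨hβ, fun w hw => one_pos.trans_le (hβ1 w hw)⟩
  obtain ⟨w, x, hw, hx, rfl⟩ : ∃ w x, w ∈ J ∧ x ∈ coordDomain φ ∧ joinCoord w x = y :=
    ⟨_, _, hy.1, hy.2, joinCoord_eta y⟩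
  have h1 : 1 ≤ β w := hβ1 w hw
  have hb : 0 < β w := hpos.pos w hw
  refine lt_of_lt_of_eq ?_ (scalarCurvature_warped (hg.isSmoothFamily hJ hφ) hpos hw hx).symm
  have hc0 : 0 < (β w ^ 2)⁻¹ := by positivity
  have hc1 : (β w ^ 2)⁻¹ ≤ 1 := inv_le_one_of_one_le₀ (one_le_pow₀ h1)
  have hR := hslice w hw φ hφ x hx
  have hR1 := h φ hφ _ hy
  have ht := trace_derivWithin_nonneg hg hφ hw (fun φ hφ => hmono φ hφ w hw) hx
  have hβ' : 0 ≤ derivWithin β J w / β w := div_nonneg hβm.derivWithin_nonneg hb.le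
  -- Only nonnegative, since `β w = 1` is allowed; strict positivity comes from `a2`.
  have a1 := mul_nonneg (sub_nonneg.2 hc1) hR.le
  have a2 := mul_pos hc0 hR1
  have a3 := mul_nonneg (mul_nonneg hc0.le hβ') ht
  exact add_pos_of_pos_of_nonneg (add_pos_of_nonneg_of_pos a1 a2) a3

end Paths

end

theorem lemma13 {n : ℕ} {M : Type*} [TopologicalSpace M]
    [ChartedSpace (EuclideanSpace ℝ (Fin n)) M] [IsManifold (𝓡 n) ∞ M]
    (ε ε' : ℝ) (hε' : 0 < ε') (hε'ε : ε' ≤ ε)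
    (g : ℝ → SmoothMetric n M) (hg : IsSmoothPath (Icc (-ε) 0) g)
    (hpsc : CollarHasPSC (Icc (-ε) 0) (fun _ => 1) g)
    (hslice : ∀ w ∈ Icc (-ε') 0, HasPSC (g w))
    (hmono : ∀ φ ∈ IsManifold.maximalAtlas (𝓡 n) ∞ M, ∀ w ∈ Icc (-ε') 0, ∀ x ∈ coordDomain φ,
      0 ≤ ∑ i : Fin n, derivWithin (fun t => metricMatrix φ (g t) x i i) (Icc (-ε) 0) w)
    (Λ : ℝ) (hΛ : 1 ≤ Λ) :
    ∃ β : ℝ → ℝ, ContDiffOn ℝ ∞ β (Icc (-ε') 0) ∧ MonotoneOn β (Icc (-ε') 0) ∧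
      (∀ w ∈ Icc (-ε') 0, 0 < β w) ∧
      (∀ w ∈ Icc (-ε') (-ε' / 2), β w = 1) ∧
      (∀ w ∈ Icc (-ε' / 4) 0, β w = Λ) ∧
      CollarHasPSC (Icc (-ε') 0) β g := by
  have hJ : UniqueDiffOn ℝ (Icc (-ε) 0) := uniqueDiffOn_Icc (by linarith)
  have hJ' : UniqueDiffOn ℝ (Icc (-ε') 0) := uniqueDiffOn_Icc (by linarith)
  have hJJ' : Icc (-ε') 0 ⊆ Icc (-ε) 0 := Icc_subset_Icc_left (by linarith)
  -- The argument of the transition runs from 0 at -ε'/2 to 1 at -ε'/4, exactly where `β` must leave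
  -- 1 and reach `Λ`.
  let β : ℝ → ℝ := fun w => 1 + (Λ - 1) * Real.smoothTransition ((w + ε' / 2) / (ε' / 4))
  have hβ : ContDiff ℝ ∞ β :=
    contDiff_const.add (contDiff_const.mul (Real.smoothTransition.contDiff.comp (by fun_prop)))
  have hβm : Monotone β := fun a b hab => by
    refine add_le_add_right (mul_le_mul_of_nonneg_left ?_ (by linarith)) 1
    exact Real.smoothTransition.monotone (by gcongr)
  have hβ1 : ∀ w, 1 ≤ β w := fun w =>
    le_add_of_nonneg_right (mul_nonneg (by linarith) (Real.smoothTransition.nonneg _))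
  refine ⟨β, hβ.contDiffOn, hβm.monotoneOn _, fun w _ => one_pos.trans_le (hβ1 w),
    fun w hw => ?_, fun w hw => ?_, ?_⟩
  · have : (w + ε' / 2) / (ε' / 4) ≤ 0 :=
      div_nonpos_of_nonpos_of_nonneg (by linarith [hw.2]) (by positivity)
    simp [β, Real.smoothTransition.zero_of_nonpos this]
  · have : 1 ≤ (w + ε' / 2) / (ε' / 4) := by
      rw [le_div_iff₀ (by positivity)]
      linarith [hw.1]
    simp [β, Real.smoothTransition.one_of_one_le this]
  · refine (hpsc.mono hg hJ hJ' hJJ' (IsSmoothPos.one _)).stretch (hg.mono hJJ') hJ' hslice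
      (fun φ hφ w hw x hx => ?_) hβ.contDiffOn (hβm.monotoneOn _) fun w _ => hβ1 w
    -- The hypothesis differentiates within [-ε, 0], whereas `CollarHasPSC.stretch` needs
    -- derivatives within [-ε', 0].
    refine (hmono φ hφ w hw x hx).trans_eq (Finset.sum_congr rfl fun i _ => ?_)
    refine (derivWithin_subset hJJ' (hJ' w hw) ?_).symm
    exact ((hg φ hφ i i).comp (contDiffOn_id.prodMk contDiffOn_const)
      fun t ht => ⟨ht, hx⟩).differentiableOn (by simp) w (hJJ' hw)
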